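/- Let $|\beta_1\rangle,|\beta_2\rangle,|\beta_3\rangle\in\mathbb C^2\otimes\mathbb C^2$ be three distinct Bell states, i.e. three of the four vectors $(|00\rangle\pm|11\rangle)/\sqrt2$, $(|01\rangle\pm|10\rangle)/\sqrt2$, in any order. For $0<\theta<1$ put $$\rho_\theta=\theta\rho_1+(1-\theta)\rho_2,\qquad \rho_1=\tfrac23|\beta_1\rangle\langle\beta_1|+\tfrac13|\beta_2\rangle\langle\beta_2|,\qquad \rho_2=\tfrac13|\beta_1\rangle\langle\beta_1|+\tfrac23|\beta_3\rangle\langle\beta_3|.$$ A symmetric logarithmic derivative (SLD) of $\rho_\theta$ is a Hermitian matrix $L$ with $\partial_\theta\rho_\theta=\frac12(L\rho_\theta+\rho_\theta L)$, and the quantum Fisher information is $J=\mathrm{Tr}(\rho_\theta L^2)$. For a POVM $E=\{E_x\}$ (nonnegative operators with $\sum_xE_x=I$), let $P_x(\theta)=\mathrm{Tr}(\rho_\theta E_x)$, and let $F(E)=\sum_{x:P_x(\theta)\neq0}P_x(\theta)^{-1}(\partial_\theta P_x(\theta))^2$ be its Fisher information. The POVM $E$ is called QCRB-saturating (with respect to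 $L$) if for every $x$ there is a real $\lambda_x$ with $E_x^{1/2}\rho_\theta^{1/2}=\lambda_xE_x^{1/2}L\rho_\theta^{1/2}$, and $\mathrm{Tr}(E_xL\rho_\theta L)=0$ whenever $\mathrm{Tr}(E_x\rho_\theta)=0$. It perfectly distinguishes $\beta_1,\beta_2,\beta_3$ if one can assign to every outcome $x$ an index $g(x)$ such that $\langle\beta_i|E_x|\beta_i\rangle=0$ for all $i\ne g(x)$. An LOCC measurement is a POVM on $\mathbb C^2\otimes\mathbb C^2$ that is implemented by local operations (on one qubit each, with finite-dimensional ancillas allowed) and two-way classical communication, in finitely many rounds, or that is a pointwise limit of such POVMs (in particular, with infinitely many rounds). Then, for every $\theta\in(0,1)$: 1. $\rho_\theta$ is a density matrix of rank three, and $L_\theta=\frac1{1+\theta}|\beta_1\rangle\langle\beta_1|+\frac1\theta|\beta_2\rangle\langle\beta_2|-\frac1{1-\theta}|\beta_3\rangle\langle\beta_3|$ is an SLD of it. 2. For every SLD $L$, every POVM that is QCRB-saturating, or that satisfies $F(E)=J$, perfectly distinguishes $\beta_1,\beta_2,\beta_3$. 3. No LOCC measurement perfectly distinguishes $\beta_1,\beta_2,\beta_3$.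 4. Consequently no LOCC measurement saturates the quantum Cramér–Rao bound for $\rho_\theta$: for every SLD $L$, every LOCC measurement $E$ fails to be QCRB-saturating, and $F(E)<J$. In particular, LOCC is not sufficient to saturate the quantum Cramér–Rao bound for arbitrary mixed states. -/

import Mathlib

open scoped Matrix Kronecker MatrixOrder ComplexOrder ENNReal

/-- The rank-one operator `|v⟩⟨w|`. -/
def ketBra {d : Type*} (v w : d → ℂ) : Matrix d d ℂ :=
  Matrix.vecMulVec v (star w)

section Measurements

variable {d : Type*} [Fintype d] [DecidableEq d] {X : Type*}

/-- A (discrete) positive-operator valued measurement on `ℂ^d` with outcomes in `X`: nonnegative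
operators that sum to the identity. -/
def IsPOVM (E : X → Matrix d d ℂ) : Prop :=
  (∀ x, (E x).PosSemidef) ∧ HasSum E 1

/-- The probability `P_x(t) = Tr(ρ_t E_x)` of the outcome `x`. -/
noncomputable def outcomeProb (ρ : ℝ → Matrix d d ℂ) (E : X → Matrix d d ℂ) (x : X) (t : ℝ) : ℝ :=
  (ρ t * E x).trace.re

/-- The classical Fisher information `∑_x P_x'(θ)² / P_x(θ)` of the outcome distribution, the sum
being over the outcomes with `P_x(θ) ≠ 0` (the other summands are `0` by `a / 0 = 0`). -/
noncomputable def fisherInfo (ρ : ℝ → Matrix d d ℂ) (θ : ℝ) (E : X → Matrix d d ℂ) : ℝ≥0∞ :=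
  ∑' x, ENNReal.ofReal (deriv (outcomeProb ρ E x) θ ^ 2 / outcomeProb ρ E x θ)

/-- `L` is a symmetric logarithmic derivative of the family `ρ` at `θ`: it is Hermitian and
`∂_θ ρ_θ = (L ρ_θ + ρ_θ L) / 2`. -/
def IsSLD (ρ : ℝ → Matrix d d ℂ) (θ : ℝ) (L : Matrix d d ℂ) : Prop :=
  L.IsHermitian ∧ HasDerivAt ρ ((1 / 2 : ℂ) • (L * ρ θ + ρ θ * L)) θ

/-- The quantum Fisher information `Tr(ρ L²)`, where `L` is a symmetric logarithmic derivative. -/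
noncomputable def quantumFisherInfo (ρ L : Matrix d d ℂ) : ℝ :=
  (ρ * (L * L)).trace.re

/-- The POVM `E` is QCRB-saturating for the state `ρ` with symmetric logarithmic derivative `L`:
for every outcome `x`, `E_x^{1/2} ρ^{1/2} = λ_x E_x^{1/2} L ρ^{1/2}` for some real `λ_x`, and
`Tr(E_x L ρ L) = 0` whenever `Tr(E_x ρ) = 0`. -/
def IsQCRBSaturating (ρ L : Matrix d d ℂ) (E : X → Matrix d d ℂ) : Prop :=
  (∀ x, ∃ c : ℝ, CFC.sqrt (E x) * CFC.sqrt ρ = (c : ℂ) • (CFC.sqrt (E x) * L * CFC.sqrt ρ)) ∧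
  ∀ x, (E x * ρ).trace = 0 → (E x * L * ρ * L).trace = 0

/-- The measurement `E` identifies with certainty which of the pure states `ψ i` was prepared:
there is a guess `g x` for every outcome `x`, and under `ψ i` an outcome with a wrong guess
has probability `0`. -/
def PerfectlyDistinguishes {ι : Type*} (E : X → Matrix d d ℂ) (ψ : ι → d → ℂ) : Prop :=
  ∃ g : X → ι, ∀ x i, i ≠ g x → star (ψ i) ⬝ᵥ (E x *ᵥ ψ i) = 0

end Measurements

/-- `FiniteRoundLOCC m n E`: the family `E` is the POVM of a finite-round LOCC protocol on
`ℂ^m ⊗ ℂ^n`, the first factor being held by Alice and the second by Bob.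

* `output x`: the protocol ends with the outcome `x`.
* `alice K F E`: Alice applies a local measurement with Kraus operators `K i : ℂ^m → ℂ^(a i)`,
  `∑ᵢ Kᵢ† Kᵢ = 1`, announces the result `i`, and the parties go on with an LOCC protocol with POVM
  `F i`, which may depend on `i`. The overall POVM is `E_x = ∑ᵢ (Kᵢ ⊗ 1)† (F i)_x (Kᵢ ⊗ 1)`.
* `bob K F E`: the same with the parties exchanged.

The local dimensions may change, so that the parties may use local ancillas. Forgetting
information is covered as well: `F` may be the same for several `i`, and the same
final outcome may occur in several branches. -/
inductive FiniteRoundLOCC {X : Type*} [DecidableEq X] :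
    (m n : ℕ) → (X → Matrix (Fin m × Fin n) (Fin m × Fin n) ℂ) → Prop
  | output {m n : ℕ} (x : X) : FiniteRoundLOCC m n (fun y => if y = x then 1 else 0)
  | alice {m n : ℕ} {ι : Type} [Countable ι] (a : ι → ℕ)
      (K : (i : ι) → Matrix (Fin (a i)) (Fin m) ℂ)
      (F : (i : ι) → X → Matrix (Fin (a i) × Fin n) (Fin (a i) × Fin n) ℂ)
      (E : X → Matrix (Fin m × Fin n) (Fin m × Fin n) ℂ)
      (hK : HasSum (fun i => (K i)ᴴ * K i) 1)
      (hF : ∀ i, FiniteRoundLOCC (a i) n (F i))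
      (hE : ∀ x, HasSum (fun i =>
        (K i ⊗ₖ (1 : Matrix (Fin n) (Fin n) ℂ))ᴴ * F i x *
          (K i ⊗ₖ (1 : Matrix (Fin n) (Fin n) ℂ))) (E x)) :
      FiniteRoundLOCC m n E
  | bob {m n : ℕ} {ι : Type} [Countable ι] (b : ι → ℕ)
      (K : (i : ι) → Matrix (Fin (b i)) (Fin n) ℂ)
      (F : (i : ι) → X → Matrix (Fin m × Fin (b i)) (Fin m × Fin (b i)) ℂ)
      (E : X → Matrix (Fin m × Fin n) (Fin m × Fin n) ℂ)
      (hK : HasSum (fun i => (K i)ᴴ * K i) 1)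
      (hF : ∀ i, FiniteRoundLOCC m (b i) (F i))
      (hE : ∀ x, HasSum (fun i =>
        ((1 : Matrix (Fin m) (Fin m) ℂ) ⊗ₖ K i)ᴴ * F i x *
          ((1 : Matrix (Fin m) (Fin m) ℂ) ⊗ₖ K i)) (E x)) :
      FiniteRoundLOCC m n E

/-- LOCC measurements in the widest sense: POVMs that are pointwise limits of POVMs of finite-round
LOCC protocols. These include all finite-round LOCC measurements and those with
infinitely many rounds, which are defined as limits of finite-round ones. -/
def IsLOCCMeasurement {X : Type*} [DecidableEq X] {m n : ℕ}
    (E : X → Matrix (Fin m × Fin n) (Fin m × Fin n) ℂ) : Prop :=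
  IsPOVM E ∧ E ∈ closure {F | FiniteRoundLOCC m n F}

section BellStates

/-- The vector `|i j⟩` of two qubits. -/
def ket (i j : Fin 2) : Fin 2 × Fin 2 → ℂ := Pi.single (i, j) 1

/-- The four Bell states `(|00⟩ ± |11⟩)/√2` and `(|01⟩ ± |10⟩)/√2`. -/
noncomputable def bell : Fin 4 → (Fin 2 × Fin 2 → ℂ) :=
  ![((1 / √2 : ℝ) : ℂ) • (ket 0 0 + ket 1 1), ((1 / √2 : ℝ) : ℂ) • (ket 0 0 - ket 1 1),
    ((1 / √2 : ℝ) : ℂ) • (ket 0 1 + ket 1 0), ((1 / √2 : ℝ) : ℂ) • (ket 0 1 - ket 1 0)]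

/-- `ρ₁ = 2/3 |β₁⟩⟨β₁| + 1/3 |β₂⟩⟨β₂|`, the vectors `β₁, β₂, β₃` being `β 0, β 1, β 2`. -/
noncomputable def rhoOne (β : Fin 3 → (Fin 2 × Fin 2 → ℂ)) :
    Matrix (Fin 2 × Fin 2) (Fin 2 × Fin 2) ℂ :=
  (2 / 3 : ℂ) • ketBra (β 0) (β 0) + (1 / 3 : ℂ) • ketBra (β 1) (β 1)

/-- `ρ₂ = 1/3 |β₁⟩⟨β₁| + 2/3 |β₃⟩⟨β₃|`. -/
noncomputable def rhoTwo (β : Fin 3 → (Fin 2 × Fin 2 → ℂ)) :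
    Matrix (Fin 2 × Fin 2) (Fin 2 × Fin 2) ℂ :=
  (1 / 3 : ℂ) • ketBra (β 0) (β 0) + (2 / 3 : ℂ) • ketBra (β 2) (β 2)

/-- The family `ρ_θ = θ ρ₁ + (1 - θ) ρ₂`. -/
noncomputable def rhoFamily (β : Fin 3 → (Fin 2 × Fin 2 → ℂ)) (θ : ℝ) :
    Matrix (Fin 2 × Fin 2) (Fin 2 × Fin 2) ℂ :=
  (θ : ℂ) • rhoOne β + ((1 - θ : ℝ) : ℂ) • rhoTwo β

/-- The operator
`(1 + θ)⁻¹ |β₁⟩⟨β₁| + θ⁻¹ |β₂⟩⟨β₂| - (1 - θ)⁻¹ |β₃⟩⟨β₃|`. -/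
noncomputable def sldFamily (β : Fin 3 → (Fin 2 × Fin 2 → ℂ)) (θ : ℝ) :
    Matrix (Fin 2 × Fin 2) (Fin 2 × Fin 2) ℂ :=
  ((1 / (1 + θ) : ℝ) : ℂ) • ketBra (β 0) (β 0) + ((1 / θ : ℝ) : ℂ) • ketBra (β 1) (β 1)
    + ((-1 / (1 - θ) : ℝ) : ℂ) • ketBra (β 2) (β 2)

end BellStates

/-! Saturating the bound forces perfect discrimination, and positivity of the partial transpose
forbids it. The state is diagonal in the orthonormal `β i`, with positive weights, and every SLD
acts on their span with three distinct eigenvalues (`IsSLD.mul_columns`,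
`sldEigenvalues_injective`). The saturation condition annihilates `E x *ᵥ β i` unless the eigenvalue
at `i` is the reciprocal of the constant, so at most one `i` survives per outcome. Likewise `F(E) ≤
J` is Cauchy–Schwarz outcome by outcome, and equality forces the eigenvalue to be constant on the
states that can produce the outcome. LOCC effects have a positive partial transpose. The partial
transpose of a Bell projector is `1/2` minus another Bell projector, so such an effect has
expectation at most `Tr (E x) / 2` in any Bell state. If three Bell states were distinguished,
summing over outcomes would give `3 ≤ Tr 1 / 2 = 2`. -/

section PartialTranspose

/-! ### Partial transposition and LOCC effects. -/

variable {m n : Type*}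

/-- The partial transpose with respect to the second factor. -/
def partialTranspose (M : Matrix (m × n) (m × n) ℂ) : Matrix (m × n) (m × n) ℂ :=
  Matrix.of fun a b => M (a.1, b.2) (b.1, a.2)

@[simp]
theorem partialTranspose_apply (M : Matrix (m × n) (m × n) ℂ) (a b : m × n) :
    partialTranspose M a b = M (a.1, b.2) (b.1, a.2) := rfl

theorem continuous_partialTranspose :
    Continuous (partialTranspose : Matrix (m × n) (m × n) ℂ → Matrix (m × n) (m × n) ℂ) :=
  continuous_matrix fun _ _ => Continuous.matrix_elem continuous_id _ _

theorem HasSum.partialTranspose {ι : Type*} {f : ι → Matrix (m × n) (m × n) ℂ}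
    {M : Matrix (m × n) (m × n) ℂ} (h : HasSum f M) :
    HasSum (fun i => partialTranspose (f i)) (partialTranspose M) :=
  h.map (⟨⟨_root_.partialTranspose, rfl⟩, fun _ _ => rfl⟩ :
    Matrix (m × n) (m × n) ℂ →+ Matrix (m × n) (m × n) ℂ) continuous_partialTranspose

theorem isClosed_posSemidef {d : Type*} [Fintype d] :
    IsClosed {M : Matrix d d ℂ | M.PosSemidef} := by
  simp only [Matrix.posSemidef_iff_dotProduct_mulVec, Set.ofPred_and, Set.ofPred_forall]
  refine IsClosed.inter (isClosed_eq (by fun_prop) continuous_id) (isClosed_iInter fun x => ?_)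
  exact isClosed_le continuous_const (by fun_prop)

theorem HasSum.posSemidef {d ι : Type*} [Fintype d] {f : ι → Matrix d d ℂ} {M : Matrix d d ℂ}
    (h : HasSum f M) (hf : ∀ i, (f i).PosSemidef) : M.PosSemidef :=
  isClosed_posSemidef.mem_of_tendsto h
    (Filter.Eventually.of_forall fun s => Matrix.posSemidef_sum s fun i _ => hf i)

theorem partialTranspose_conj_left {m' : Type*} [Fintype m] [Fintype m'] [Fintype n]
    [DecidableEq n] (K : Matrix m' m ℂ) (M : Matrix (m' × n) (m' × n) ℂ) :
    partialTranspose ((K ⊗ₖ (1 : Matrix n n ℂ))ᴴ * M * (K ⊗ₖ (1 : Matrix n n ℂ))) =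
      (K ⊗ₖ (1 : Matrix n n ℂ))ᴴ * partialTranspose M * (K ⊗ₖ (1 : Matrix n n ℂ)) := by
  ext ⟨a, b⟩ ⟨c, e⟩
  simp [Matrix.mul_apply, Matrix.kroneckerMap_apply, Fintype.sum_prod_type, Matrix.one_apply,
    apply_ite]

/-- Transposing the second factor reverses the order of the Kraus factors there, so `K` is replaced
by its entrywise conjugate. The result is still a congruence, which preserves positivity. -/
theorem partialTranspose_conj_right {n' : Type*} [Fintype m] [Fintype n'] [Fintype n]
    [DecidableEq m] (K : Matrix n' n ℂ) (M : Matrix (m × n') (m × n') ℂ) :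
    partialTranspose (((1 : Matrix m m ℂ) ⊗ₖ K)ᴴ * M * ((1 : Matrix m m ℂ) ⊗ₖ K)) =
      ((1 : Matrix m m ℂ) ⊗ₖ K.map star)ᴴ * partialTranspose M *
        ((1 : Matrix m m ℂ) ⊗ₖ K.map star) := by
  ext ⟨a, b⟩ ⟨c, e⟩
  simp [Matrix.mul_apply, Matrix.kroneckerMap_apply, Fintype.sum_prod_type, Matrix.one_apply,
    apply_ite, Finset.sum_mul]
  rw [Finset.sum_comm]
  exact Finset.sum_congr rfl fun _ _ => Finset.sum_congr rfl fun _ _ => by ring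

end PartialTranspose

/-- Each round is a sum of congruences by local operators, under which positivity of the partial
transpose is stable. -/
theorem FiniteRoundLOCC.posSemidef_partialTranspose {X : Type*} [DecidableEq X] {m n : ℕ}
    {E : X → Matrix (Fin m × Fin n) (Fin m × Fin n) ℂ} (h : FiniteRoundLOCC m n E) (x : X) :
    (partialTranspose (E x)).PosSemidef := by
  induction h with
  | @output m n y =>
    have h1 : partialTranspose (1 : Matrix (Fin m × Fin n) (Fin m × Fin n) ℂ) = 1 := by
      ext ⟨a, b⟩ ⟨c, e⟩
      simp [Matrix.one_apply, eq_comm]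
    have h0 : partialTranspose (0 : Matrix (Fin m × Fin n) (Fin m × Fin n) ℂ) = 0 := rfl
    dsimp only
    split_ifs
    · rw [h1]; exact Matrix.PosSemidef.one
    · rw [h0]; exact Matrix.PosSemidef.zero
  | alice a K F E hK hF hE ih =>
    refine (hE x).partialTranspose.posSemidef fun i => ?_
    rw [partialTranspose_conj_left]
    exact (ih i).conjTranspose_mul_mul_same _
  | bob b K F E hK hF hE ih =>
    refine (hE x).partialTranspose.posSemidef fun i => ?_
    rw [partialTranspose_conj_right]
    exact (ih i).conjTranspose_mul_mul_same _

theorem IsLOCCMeasurement.posSemidef_partialTranspose {X : Type*} [DecidableEq X] {m n : ℕ}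
    {E : X → Matrix (Fin m × Fin n) (Fin m × Fin n) ℂ} (h : IsLOCCMeasurement E) (x : X) :
    (partialTranspose (E x)).PosSemidef := by
  have hc : IsClosed {F : X → Matrix (Fin m × Fin n) (Fin m × Fin n) ℂ |
      (partialTranspose (F x)).PosSemidef} :=
    isClosed_posSemidef.preimage (continuous_partialTranspose.comp (continuous_apply x))
  exact closure_minimal (fun F hF => hF.posSemidef_partialTranspose x) hc h.2

/-! ### Bell states cannot be distinguished by PPT measurements. -/

section Bell

theorem star_bell_dotProduct_bell (i j : Fin 4) :
    star (bell i) ⬝ᵥ bell j = if i = j then 1 else 0 := by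
  have h : ((√2 : ℝ) : ℂ) * ((√2 : ℝ) : ℂ) = 2 := by
    rw [← Complex.ofReal_mul, Real.mul_self_sqrt (by norm_num)]; norm_num
  have h' : ((√2 : ℝ) : ℂ)⁻¹ * ((√2 : ℝ) : ℂ)⁻¹ = 1 / 2 := by
    rw [← mul_inv, h]; norm_num
  fin_cases i <;> fin_cases j <;>
    simp [bell, ket, dotProduct, Fintype.sum_prod_type, Pi.single_apply, h'] <;> norm_num

/-- The expectation of `M` in a Bell state and that of its partial transpose in the opposite Bell
state add up to half the trace. -/
theorem star_bell_dotProduct_mulVec_add (i : Fin 4)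
    (M : Matrix (Fin 2 × Fin 2) (Fin 2 × Fin 2) ℂ) :
    star (bell i) ⬝ᵥ (M *ᵥ bell i) + star (bell i.rev) ⬝ᵥ (partialTranspose M *ᵥ bell i.rev) =
      M.trace / 2 := by
  have h : ((√2 : ℝ) : ℂ) ^ 2 = 2 := by
    rw [← Complex.ofReal_pow, Real.sq_sqrt (by norm_num)]; norm_num
  have h' : (((√2 : ℝ) : ℂ)⁻¹) ^ 2 = 1 / 2 := by
    rw [inv_pow, h]; norm_num
  -- `Fin.rev` pairs `(|00⟩ ± |11⟩)/√2` with `(|01⟩ ∓ |10⟩)/√2`. The partial transpose of either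
  -- projector is `1/2` minus the other, and moving it onto `M` gives the identity.
  fin_cases i <;>
    simp [bell, ket, dotProduct, Matrix.mulVec, Matrix.trace, Fintype.sum_prod_type,
      Pi.single_apply, Fin.rev] <;> ring_nf <;> simp only [h'] <;> ring

theorem IsPOVM.hasSum_dotProduct_mulVec {d X : Type*} [Fintype d] [DecidableEq d]
    {E : X → Matrix d d ℂ} (h : IsPOVM E) (v : d → ℂ) :
    HasSum (fun x => star v ⬝ᵥ (E x *ᵥ v)) (star v ⬝ᵥ v) := by
  have := h.2.map (⟨⟨fun M => star v ⬝ᵥ (M *ᵥ v), by simp⟩,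
    fun A B => by simp [Matrix.add_mulVec, dotProduct_add]⟩ : Matrix d d ℂ →+ ℂ)
    (show Continuous fun M : Matrix d d ℂ => star v ⬝ᵥ (M *ᵥ v) by fun_prop)
  simpa [Function.comp_def] using this

/-- A measurement whose operators have a positive partial transpose does not perfectly distinguish
three Bell states. -/
theorem not_perfectlyDistinguishes_bell {X : Type*}
    {E : X → Matrix (Fin 2 × Fin 2) (Fin 2 × Fin 2) ℂ} (hE : IsPOVM E)
    (hppt : ∀ x, (partialTranspose (E x)).PosSemidef) (k : Fin 3 → Fin 4) :
    ¬ PerfectlyDistinguishes E (fun i => bell (k i)) := by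
  rintro ⟨g, hg⟩
  -- Only the guessed state contributes to the sum, and its expectation is at most half the trace.
  have hle : ∀ x, ∑ i, star (bell (k i)) ⬝ᵥ (E x *ᵥ bell (k i)) ≤ (E x).trace / 2 := fun x => by
    rw [Finset.sum_eq_single (g x) (fun i _ hi => hg x i hi) (by simp),
      ← star_bell_dotProduct_mulVec_add (k (g x)) (E x)]
    exact le_add_of_nonneg_right ((hppt x).dotProduct_mulVec_nonneg _)
  have htr : HasSum (fun x => (E x).trace / 2)
      ((1 : Matrix (Fin 2 × Fin 2) (Fin 2 × Fin 2) ℂ).trace / 2) :=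
    (hE.2.map (Matrix.traceAddMonoidHom _ ℂ)
      (show Continuous (Matrix.trace : Matrix (Fin 2 × Fin 2) (Fin 2 × Fin 2) ℂ → ℂ) from
        continuous_id.matrix_trace)).div_const 2
  -- Summed over outcomes, the left side is three squared norms and the right side is `4 / 2`.
  have h := hasSum_le hle (hasSum_sum fun i _ => hE.hasSum_dotProduct_mulVec (bell (k i))) htr
  simp only [star_bell_dotProduct_bell, Matrix.trace_one] at h
  norm_num at h

end Bell

/-! ### Spectral calculus on the span of an orthonormal family. -/

section Spectral

open Matrix

variable {d ι : Type*} [Fintype ι] [DecidableEq ι]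

/-- The matrix with columns `β i`. -/
def columns (β : ι → d → ℂ) : Matrix d ι ℂ := Matrix.of fun a i => β i a

/-- The operator `∑ i, q i |β i⟩⟨β i|`. -/
noncomputable def spectralSum (β : ι → d → ℂ) (q : ι → ℝ) : Matrix d d ℂ :=
  columns β * diagonal (fun i => (q i : ℂ)) * (columns β)ᴴ

theorem spectralSum_eq_sum (β : ι → d → ℂ) (q : ι → ℝ) :
    spectralSum β q = ∑ i, (q i : ℂ) • ketBra (β i) (β i) := by
  ext a b
  rw [spectralSum, Matrix.mul_apply]
  simp only [columns, ketBra, Matrix.sum_apply, vecMulVec_apply, mul_diagonal, conjTranspose_apply,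
    of_apply, Matrix.smul_apply, smul_eq_mul, Pi.star_apply]
  exact Finset.sum_congr rfl fun _ _ => by ring

variable [Fintype d]

theorem posSemidef_spectralSum (β : ι → d → ℂ) {q : ι → ℝ} (hq : ∀ i, 0 ≤ q i) :
    (spectralSum β q).PosSemidef :=
  (PosSemidef.diagonal fun i => by simpa using hq i).mul_mul_conjTranspose_same _

theorem trace_spectralSum_mul (β : ι → d → ℂ) (q : ι → ℝ) (M : Matrix d d ℂ) :
    (spectralSum β q * M).trace = ∑ i, (q i : ℂ) * (star (β i) ⬝ᵥ (M *ᵥ β i)) := by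
  rw [spectralSum, Matrix.mul_assoc, Matrix.mul_assoc, trace_mul_comm, Matrix.mul_assoc]
  simp only [Matrix.trace, diag_apply, diagonal_mul]
  refine Finset.sum_congr rfl fun i _ => ?_
  rw [Matrix.mul_assoc]
  rfl

variable {β : ι → d → ℂ} {p lam : ι → ℝ} {L : Matrix d d ℂ}

theorem trace_spectralSum (hβ : (columns β)ᴴ * columns β = 1) (q : ι → ℝ) :
    (spectralSum β q).trace = ((∑ i, q i : ℝ) : ℂ) := by
  rw [spectralSum, trace_mul_cycle, hβ, Matrix.one_mul, trace_diagonal, Complex.ofReal_sum]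

/-- Compressing to the coordinates of `β` gives an invertible diagonal matrix, which bounds the rank
from below. -/
theorem rank_spectralSum (hβ : (columns β)ᴴ * columns β = 1) {q : ι → ℝ} (hq : ∀ i, q i ≠ 0) :
    (spectralSum β q).rank = Fintype.card ι := by
  refine le_antisymm ?_ ?_
  · exact (rank_mul_le_left _ _).trans ((rank_mul_le_left _ _).trans (rank_le_card_width _))
  · have hD : (columns β)ᴴ * (spectralSum β q * columns β) = diagonal fun i => (q i : ℂ) := by
      rw [spectralSum, Matrix.mul_assoc, hβ, Matrix.mul_one, ← Matrix.mul_assoc, hβ, Matrix.one_mul]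
    have hr : (diagonal fun i => (q i : ℂ)).rank = Fintype.card ι :=
      rank_of_isUnit _ ((isUnit_diagonal).2 (Pi.isUnit_iff.2 fun i => by simpa using hq i))
    rw [← hr, ← hD]
    exact (rank_mul_le_right _ _).trans (rank_mul_le_left _ _)

theorem spectralSum_mul_columns (hβ : (columns β)ᴴ * columns β = 1) (q : ι → ℝ) :
    spectralSum β q * columns β = columns β * diagonal fun i => (q i : ℂ) := by
  rw [spectralSum, Matrix.mul_assoc, hβ, Matrix.mul_one]

theorem spectralSum_mul_spectralSum (hβ : (columns β)ᴴ * columns β = 1) (q r : ι → ℝ) :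
    spectralSum β q * spectralSum β r = spectralSum β (q * r) := by
  conv_lhs => rw [spectralSum.eq_def β r, Matrix.mul_assoc (columns β), ← Matrix.mul_assoc,
    spectralSum_mul_columns hβ, Matrix.mul_assoc, ← Matrix.mul_assoc (diagonal _),
    diagonal_mul_diagonal]
  simp [spectralSum, Matrix.mul_assoc]

/-- On the support of a state, the spectral decomposition determines its symmetric logarithmic
derivatives. -/
theorem mul_columns_of_sld (hβ : (columns β)ᴴ * columns β = 1) (hp : ∀ i, 0 < p i)
    (h : (1 / 2 : ℂ) • (L * spectralSum β p + spectralSum β p * L) = spectralSum β (p * lam)) :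
    L * columns β = columns β * diagonal fun i => (lam i : ℂ) := by
  set V := columns β with hV
  set P : Matrix ι ι ℂ := diagonal fun i => (p i : ℂ) with hP
  set Λ : Matrix ι ι ℂ := diagonal fun i => (lam i : ℂ) with hΛ
  have hPΛ : (diagonal fun i => (((p * lam) i : ℝ) : ℂ)) = P * Λ := by
    rw [hP, hΛ, diagonal_mul_diagonal]; simp
  have hΛP : Λ * P = P * Λ := by
    rw [hP, hΛ, diagonal_mul_diagonal, diagonal_mul_diagonal]; simp only [mul_comm]
  have h1 : L * V * P + V * P * (Vᴴ * (L * V)) = (2 : ℂ) • (V * (P * Λ)) := by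
    rw [← hPΛ, ← spectralSum_mul_columns hβ (p * lam), ← h, smul_mul, smul_smul, Matrix.add_mul,
      Matrix.mul_assoc L (spectralSum β p), spectralSum_mul_columns hβ, spectralSum, ← hV, ← hP]
    simp only [Matrix.mul_assoc]
    norm_num
  -- `L * V - V * Λ` measures the failure of `L` to act as `Λ` on the span; the SLD equation becomes
  -- homogeneous in it.
  have h2 : (L * V - V * Λ) * P + V * P * (Vᴴ * (L * V - V * Λ)) = 0 := by
    rw [Matrix.sub_mul, Matrix.mul_sub, Matrix.mul_sub, ← Matrix.mul_assoc Vᴴ V, hβ,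
      Matrix.one_mul, Matrix.mul_assoc V Λ, hΛP, Matrix.mul_assoc V P Λ, sub_add_sub_comm, h1,
      two_smul, sub_self]
  have h3 : Vᴴ * (L * V - V * Λ) * P + P * (Vᴴ * (L * V - V * Λ)) = 0 := by
    have := congrArg (Vᴴ * ·) h2
    simpa only [Matrix.mul_add, Matrix.mul_zero, ← Matrix.mul_assoc, hβ, Matrix.one_mul] using this
  -- Entrywise `h3` reads `(p j + p i) * y i j = 0`, with a positive factor.
  have h4 : Vᴴ * (L * V - V * Λ) = 0 := by
    ext i j
    have hij := congrFun (congrFun h3 i) j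
    rw [Matrix.add_apply, hP, mul_diagonal, diagonal_mul, mul_comm, ← add_mul] at hij
    refine (mul_eq_zero.1 hij).resolve_left ?_
    exact_mod_cast (add_pos (hp j) (hp i)).ne'
  rw [h4, Matrix.mul_zero, add_zero] at h2
  rw [← sub_eq_zero]
  ext a i
  have hai := congrFun (congrFun h2 a) i
  rw [hP, mul_diagonal] at hai
  exact (mul_eq_zero.1 hai).resolve_right (by exact_mod_cast (hp i).ne')

theorem quantumFisherInfo_spectralSum (hβ : (columns β)ᴴ * columns β = 1)
    (hL : L * columns β = columns β * diagonal fun i => (lam i : ℂ)) :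
    quantumFisherInfo (spectralSum β p) L = ∑ i, p i * lam i ^ 2 := by
  have h : (columns β)ᴴ * (L * L) * columns β = diagonal fun i => ((lam i : ℂ) * lam i) := by
    rw [Matrix.mul_assoc, Matrix.mul_assoc L, hL, ← Matrix.mul_assoc L, hL, Matrix.mul_assoc,
      diagonal_mul_diagonal, ← Matrix.mul_assoc, hβ, Matrix.one_mul]
  rw [quantumFisherInfo, spectralSum, Matrix.mul_assoc, Matrix.mul_assoc, trace_mul_comm,
    Matrix.mul_assoc, h, diagonal_mul_diagonal, trace_diagonal, Complex.re_sum]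
  refine Finset.sum_congr rfl fun i _ => ?_
  rw [← Complex.ofReal_mul, ← Complex.ofReal_mul, Complex.ofReal_re, sq]

end Spectral

/-! ### From saturation to perfect discrimination. -/

section Saturation

open Matrix

variable {d ι X : Type*} [Fintype d] [Fintype ι]
  {β : ι → d → ℂ} {p lam : ι → ℝ} {L : Matrix d d ℂ} {E : X → Matrix d d ℂ}

/-- If at most one of the states `β i` can lead to any given outcome, the states are perfectly
distinguished. -/
theorem perfectlyDistinguishes_of_forall [Nonempty ι]
    (h : ∀ x i j, i ≠ j → star (β i) ⬝ᵥ (E x *ᵥ β i) = 0 ∨ star (β j) ⬝ᵥ (E x *ᵥ β j) = 0) :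
    PerfectlyDistinguishes E β := by
  have h' : ∀ x, ∃ g, ∀ i, i ≠ g → star (β i) ⬝ᵥ (E x *ᵥ β i) = 0 := fun x => by
    by_cases hx : ∃ g, star (β g) ⬝ᵥ (E x *ᵥ β g) ≠ 0
    · obtain ⟨g, hg⟩ := hx
      exact ⟨g, fun i hi => (h x i g hi).resolve_right hg⟩
    · push Not at hx
      exact ⟨Classical.arbitrary ι, fun i _ => hx i⟩
  choose g hg using h'
  exact ⟨g, hg⟩

/-- The weighted Cauchy–Schwarz inequality behind the quantum Cramér–Rao bound. -/
theorem sum_mul_sq_div_le {q : ι → ℝ} (hq : ∀ i, 0 ≤ q i) :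
    (∑ i, q i * lam i) ^ 2 / (∑ i, q i) ≤ ∑ i, q i * lam i ^ 2 := by
  -- This form also covers zero total weight, where the quotient is `0` by convention.
  refine div_le_of_le_mul₀ (Finset.sum_nonneg fun i _ => hq i)
    (Finset.sum_nonneg fun i _ => mul_nonneg (hq i) (sq_nonneg _)) ?_
  rw [mul_comm]
  exact Finset.sum_sq_le_sum_mul_sum_of_sq_le_mul _ (fun i _ => hq i)
    (fun i _ => mul_nonneg (hq i) (sq_nonneg _)) fun i _ => by nlinarith

/-- Equality says that the variance of `lam` under the weights `q` vanishes, so `lam` equals its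
mean `T / S` wherever the weight is nonzero. -/
theorem eq_of_sum_mul_sq_div_eq {q : ι → ℝ} (hq : ∀ i, 0 ≤ q i)
    (h : (∑ i, q i * lam i) ^ 2 / (∑ i, q i) = ∑ i, q i * lam i ^ 2) {i j : ι}
    (hi : q i ≠ 0) (hj : q j ≠ 0) : lam i = lam j := by
  have hS : 0 < ∑ i, q i :=
    Finset.sum_pos' (fun i _ => hq i) ⟨i, Finset.mem_univ i, (hq i).lt_of_ne' hi⟩
  set S := ∑ i, q i with hSdef
  set T := ∑ i, q i * lam i with hT
  have h0 : ∑ i, q i * (lam i - T / S) ^ 2 = 0 := by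
    have : ∀ i, q i * (lam i - T / S) ^ 2 =
        q i * lam i ^ 2 - (q i * lam i) * (2 * (T / S)) + q i * (T / S) ^ 2 := fun i => by ring
    simp only [this, Finset.sum_add_distrib, Finset.sum_sub_distrib, ← Finset.sum_mul, ← h,
      ← hSdef, ← hT]
    field_simp
    ring
  have hk : ∀ k, q k ≠ 0 → lam k = T / S := fun k hk => by
    have := (Finset.sum_eq_zero_iff_of_nonneg
      fun i _ => mul_nonneg (hq i) (sq_nonneg _)).1 h0 k (Finset.mem_univ k)
    exact sub_eq_zero.1 (pow_eq_zero_iff two_ne_zero |>.1 ((mul_eq_zero.1 this).resolve_left hk))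
  rw [hk i hi, hk j hj]

variable [DecidableEq d] [DecidableEq ι]

/-- Multiplying out the square roots turns the condition into `E x * ρ = c • (E x * L * ρ)`. On `β
i` this reads `(1 - c * lam i) * p i • (E x *ᵥ β i) = 0`, and `c * lam i = 1` holds for at most one
`i`. -/
theorem IsQCRBSaturating.perfectlyDistinguishes [Nonempty ι]
    (hβ : (columns β)ᴴ * columns β = 1) (hp : ∀ i, 0 < p i) (hlam : Function.Injective lam)
    (hL : L * columns β = columns β * diagonal fun i => (lam i : ℂ)) (hE : IsPOVM E)
    (h : IsQCRBSaturating (spectralSum β p) L E) : PerfectlyDistinguishes E β := by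
  have hρ := posSemidef_spectralSum β fun i => (hp i).le
  refine perfectlyDistinguishes_of_forall fun x => ?_
  obtain ⟨c, hc⟩ := h.1 x
  have hs : CFC.sqrt (E x) * CFC.sqrt (E x) = E x :=
    CFC.sqrt_mul_sqrt_self _ (nonneg_iff_posSemidef.2 (hE.1 x))
  have hr : CFC.sqrt (spectralSum β p) * CFC.sqrt (spectralSum β p) = spectralSum β p :=
    CFC.sqrt_mul_sqrt_self _ (nonneg_iff_posSemidef.2 hρ)
  have h1 : E x * spectralSum β p = (c : ℂ) • (E x * L * spectralSum β p) := by
    have : CFC.sqrt (E x) * (CFC.sqrt (E x) * CFC.sqrt (spectralSum β p)) *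
        CFC.sqrt (spectralSum β p) = _ :=
      congrArg (fun M => CFC.sqrt (E x) * M * CFC.sqrt (spectralSum β p)) hc
    rw [Matrix.mul_smul, Matrix.smul_mul] at this
    calc E x * spectralSum β p
        = CFC.sqrt (E x) * (CFC.sqrt (E x) * CFC.sqrt (spectralSum β p)) *
            CFC.sqrt (spectralSum β p) := by
          rw [← Matrix.mul_assoc, hs, Matrix.mul_assoc, hr]
      _ = _ := by
          rw [this, Matrix.mul_assoc, Matrix.mul_assoc, hr, ← Matrix.mul_assoc,
            ← Matrix.mul_assoc, hs]
  have h2 : E x * columns β * (diagonal fun i => (p i : ℂ)) =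
      (c : ℂ) • (E x * columns β * diagonal fun i => ((lam i : ℂ) * p i)) := by
    have := congrArg (· * columns β) h1
    simp only [smul_mul, Matrix.mul_assoc, spectralSum_mul_columns hβ] at this
    rw [← Matrix.mul_assoc L, hL, Matrix.mul_assoc (columns β), diagonal_mul_diagonal] at this
    simpa only [Matrix.mul_assoc] using this
  have h3 : ∀ i, c * lam i ≠ 1 → star (β i) ⬝ᵥ (E x *ᵥ β i) = 0 := fun i hi => by
    suffices E x *ᵥ β i = 0 by rw [this, dotProduct_zero]
    ext a
    have ha := congrFun (congrFun h2 a) i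
    rw [Matrix.smul_apply, mul_diagonal, mul_diagonal, smul_eq_mul] at ha
    have h0 : (1 - (c : ℂ) * lam i) * p i ≠ 0 := by
      refine mul_ne_zero (sub_ne_zero.2 fun h => hi ?_) (by exact_mod_cast (hp i).ne')
      exact_mod_cast h.symm
    have h5 : ((1 - (c : ℂ) * lam i) * p i) * (E x * columns β) a i = 0 := by
      linear_combination ha
    exact (mul_eq_zero.1 h5).resolve_left h0
  intro i j hij
  by_cases hi : c * lam i = 1
  · refine Or.inr (h3 j fun hj => hij (hlam (mul_left_cancel₀ ?_ (hi.trans hj.symm))))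
    rintro rfl
    simp at hi
  · exact Or.inl (h3 i hi)

/-- The Fisher information of a measurement is at most the quantum Fisher information, and a
measurement that attains it perfectly distinguishes the eigenstates if the eigenvalues of the
symmetric logarithmic derivative are distinct. -/
theorem fisherInfo_le_and_perfectlyDistinguishes [Nonempty ι]
    (hβ : (columns β)ᴴ * columns β = 1) (hp : ∀ i, 0 < p i) (hlam : Function.Injective lam)
    (hL : L * columns β = columns β * diagonal fun i => (lam i : ℂ)) (hE : IsPOVM E)
    {ρ : ℝ → Matrix d d ℂ} {θ : ℝ}
    (hP : ∀ x, outcomeProb ρ E x θ = ∑ i, p i * (star (β i) ⬝ᵥ (E x *ᵥ β i)).re)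
    (hP' : ∀ x, deriv (outcomeProb ρ E x) θ =
      ∑ i, p i * lam i * (star (β i) ⬝ᵥ (E x *ᵥ β i)).re) :
    fisherInfo ρ θ E ≤ ENNReal.ofReal (quantumFisherInfo (spectralSum β p) L) ∧
      (fisherInfo ρ θ E = ENNReal.ofReal (quantumFisherInfo (spectralSum β p) L) →
        PerfectlyDistinguishes E β) := by
  set e : X → ι → ℝ := fun x i => (star (β i) ⬝ᵥ (E x *ᵥ β i)).re with he
  have hnn : ∀ x i, 0 ≤ star (β i) ⬝ᵥ (E x *ᵥ β i) := fun x i =>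
    (hE.1 x).dotProduct_mulVec_nonneg _
  have hq : ∀ x i, 0 ≤ p i * e x i := fun x i =>
    mul_nonneg (hp i).le (Complex.nonneg_iff.1 (hnn x i)).1
  have hterm : ∀ x, deriv (outcomeProb ρ E x) θ ^ 2 / outcomeProb ρ E x θ =
      (∑ i, p i * e x i * lam i) ^ 2 / ∑ i, p i * e x i := fun x => by
    rw [hP, hP']; simp only [he, mul_right_comm]
  have hle : ∀ x, deriv (outcomeProb ρ E x) θ ^ 2 / outcomeProb ρ E x θ ≤
      ∑ i, p i * e x i * lam i ^ 2 := fun x => (hterm x).trans_le (sum_mul_sq_div_le (hq x))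
  -- Completeness of the POVM splits `J = ∑ i, p i * lam i ^ 2` over the outcomes, so the two
  -- informations can be compared term by term.
  have hsum : HasSum (fun x => ∑ i, p i * e x i * lam i ^ 2)
      (quantumFisherInfo (spectralSum β p) L) := by
    rw [quantumFisherInfo_spectralSum hβ hL]
    refine hasSum_sum fun i _ => ?_
    have hone : star (β i) ⬝ᵥ β i = 1 := (congrFun (congrFun hβ i) i).trans (one_apply_eq i)
    have := ((Complex.hasSum_re (hE.hasSum_dotProduct_mulVec (β i))).mul_left (p i)).mul_right
      (lam i ^ 2)
    simpa only [hone, Complex.one_re, mul_one] using this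
  have hnonneg : ∀ x, 0 ≤ ∑ i, p i * e x i * lam i ^ 2 := fun x =>
    Finset.sum_nonneg fun i _ => mul_nonneg (hq x i) (sq_nonneg _)
  have hJ : ENNReal.ofReal (quantumFisherInfo (spectralSum β p) L) =
      ∑' x, ENNReal.ofReal (∑ i, p i * e x i * lam i ^ 2) := by
    rw [← hsum.tsum_eq, ENNReal.ofReal_tsum_of_nonneg hnonneg hsum.summable]
  have hF : fisherInfo ρ θ E ≤ ENNReal.ofReal (quantumFisherInfo (spectralSum β p) L) := by
    rw [hJ]
    exact ENNReal.tsum_le_tsum fun x => ENNReal.ofReal_le_ofReal (hle x)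
  refine ⟨hF, fun heq => perfectlyDistinguishes_of_forall fun x i j hij => ?_⟩
  by_contra! hne
  have hpe : ∀ k, star (β k) ⬝ᵥ (E x *ᵥ β k) ≠ 0 → p k * e x k ≠ 0 := fun k hk => by
    refine mul_ne_zero (hp k).ne' fun h0 => hk (Complex.ext h0 ?_)
    exact (Complex.nonneg_iff.1 (hnn x k)).2.symm
  have hlt : deriv (outcomeProb ρ E x) θ ^ 2 / outcomeProb ρ E x θ <
      ∑ i, p i * e x i * lam i ^ 2 := by
    refine (hle x).lt_of_ne fun h => hij (hlam ?_)
    exact eq_of_sum_mul_sq_div_eq (hq x) ((hterm x).symm.trans h) (hpe i hne.1) (hpe j hne.2)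
  have hpos : 0 < ∑ i, p i * e x i * lam i ^ 2 := by
    refine lt_of_le_of_lt ?_ hlt
    rw [hterm]
    exact div_nonneg (sq_nonneg _) (Finset.sum_nonneg fun i _ => hq x i)
  -- In `ℝ≥0∞` one strict term makes the sum strict only if the smaller sum is finite; this follows
  -- from the assumed equality with `J`.
  have : fisherInfo ρ θ E < ∑' x, ENNReal.ofReal (∑ i, p i * e x i * lam i ^ 2) :=
    ENNReal.tsum_lt_tsum (i := x) (by rw [← fisherInfo, heq]; exact ENNReal.ofReal_ne_top)
      (fun y => ENNReal.ofReal_le_ofReal (hle y)) ((ENNReal.ofReal_lt_ofReal_iff hpos).2 hlt)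
  exact this.ne (heq.trans hJ)

end Saturation

/-! ### Derivatives of matrix curves, through an auxiliary norm. -/

section MatrixDerivative

attribute [local instance] Matrix.normedAddCommGroup Matrix.normedSpace

theorem hasDerivAt_matrix_affine {d : Type*} [Fintype d] (A B : Matrix d d ℂ) (t : ℝ) :
    HasDerivAt (fun t : ℝ => A + t • B) B t := by
  have h := ((hasDerivAt_id t).smul_const B).const_add A
  rw [one_smul] at h
  exact h

theorem hasDerivAt_matrix_unique {d : Type*} [Fintype d] {ρ : ℝ → Matrix d d ℂ}
    {A B : Matrix d d ℂ} {t : ℝ} (hA : HasDerivAt ρ A t) (hB : HasDerivAt ρ B t) : A = B :=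
  HasDerivAt.unique (F := Matrix d d ℂ) hA hB

end MatrixDerivative

/-! ### The family `rhoFamily` and its symmetric logarithmic derivatives. -/

section BellFamily

/-- The eigenvalues of `rhoFamily β θ` on `β 0, β 1, β 2`. -/
noncomputable def rhoEigenvalues (θ : ℝ) : Fin 3 → ℝ :=
  ![(1 + θ) / 3, θ / 3, 2 * (1 - θ) / 3]

/-- The eigenvalues of `sldFamily β θ` on `β 0, β 1, β 2`. -/
noncomputable def sldEigenvalues (θ : ℝ) : Fin 3 → ℝ :=
  ![1 / (1 + θ), 1 / θ, -1 / (1 - θ)]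

variable {β : Fin 3 → (Fin 2 × Fin 2 → ℂ)} {θ : ℝ}

theorem rhoFamily_eq_spectralSum (β : Fin 3 → (Fin 2 × Fin 2 → ℂ)) (t : ℝ) :
    rhoFamily β t = spectralSum β (rhoEigenvalues t) := by
  rw [spectralSum_eq_sum]
  simp only [rhoFamily, rhoOne, rhoTwo, rhoEigenvalues, Fin.sum_univ_three, Matrix.cons_val]
  push_cast
  module

theorem sldFamily_eq_spectralSum (β : Fin 3 → (Fin 2 × Fin 2 → ℂ)) (t : ℝ) :
    sldFamily β t = spectralSum β (sldEigenvalues t) := by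
  rw [spectralSum_eq_sum]
  simp only [sldFamily, sldEigenvalues, Fin.sum_univ_three, Matrix.cons_val]

theorem rhoEigenvalues_pos (hθ : θ ∈ Set.Ioo (0 : ℝ) 1) (i : Fin 3) : 0 < rhoEigenvalues θ i := by
  obtain ⟨h0, h1⟩ := hθ
  fin_cases i <;> simp [rhoEigenvalues] <;> linarith

/-- The right side lists the eigenvalues of `ρ₁ - ρ₂`, the derivative of the family. Since
everything commutes, this is the SLD equation read on eigenvalues. -/
theorem rhoEigenvalues_mul_sldEigenvalues (hθ : θ ∈ Set.Ioo (0 : ℝ) 1) :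
    rhoEigenvalues θ * sldEigenvalues θ = ![1 / 3, 1 / 3, -2 / 3] := by
  obtain ⟨h0, h1⟩ := hθ
  have h2 : 1 + θ ≠ 0 := by linarith
  have h3 : 1 - θ ≠ 0 := by linarith
  ext i
  fin_cases i <;> simp [rhoEigenvalues, sldEigenvalues] <;> field_simp

/-- The order is `-1 / (1 - θ) < 0 < 1 / (1 + θ) < 1 / θ`. Distinctness is what makes saturation
separate all three states. -/
theorem sldEigenvalues_injective (hθ : θ ∈ Set.Ioo (0 : ℝ) 1) :
    Function.Injective (sldEigenvalues θ) := by
  obtain ⟨h0, h1⟩ := hθ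
  have h01 : sldEigenvalues θ 0 < sldEigenvalues θ 1 :=
    one_div_lt_one_div_of_lt h0 (by linarith)
  have h20 : sldEigenvalues θ 2 < sldEigenvalues θ 0 :=
    (div_neg_of_neg_of_pos (by norm_num) (by linarith)).trans (one_div_pos.2 (by linarith))
  intro i j hij
  fin_cases i <;> fin_cases j <;> first | rfl | (simp at hij; linarith)

theorem hasDerivAt_rhoEigenvalues (t : ℝ) (i : Fin 3) :
    HasDerivAt (fun t => rhoEigenvalues t i) ((![1 / 3, 1 / 3, -2 / 3] : Fin 3 → ℝ) i) t := by
  have hid := hasDerivAt_id t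
  fin_cases i
  · exact (hid.const_add 1).div_const 3
  · exact hid.div_const 3
  · exact (((hid.const_sub 1).const_mul 2).div_const 3).congr_deriv (by simp)

theorem hasDerivAt_rhoFamily (β : Fin 3 → (Fin 2 × Fin 2 → ℂ)) (hθ : θ ∈ Set.Ioo (0 : ℝ) 1) :
    HasDerivAt (rhoFamily β) (spectralSum β (rhoEigenvalues θ * sldEigenvalues θ)) θ := by
  rw [rhoEigenvalues_mul_sldEigenvalues hθ]
  have h : rhoFamily β = fun t => rhoTwo β + t • (rhoOne β - rhoTwo β) := by
    ext1 t
    rw [rhoFamily, ← Complex.coe_smul]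
    push_cast
    module
  have h' : spectralSum β ![1 / 3, 1 / 3, -2 / 3] = rhoOne β - rhoTwo β := by
    rw [spectralSum_eq_sum]
    simp only [rhoOne, rhoTwo, Fin.sum_univ_three, Matrix.cons_val]
    push_cast
    module
  rw [h, h']
  exact hasDerivAt_matrix_affine _ _ θ

theorem outcomeProb_rhoFamily {X : Type*}
    (E : X → Matrix (Fin 2 × Fin 2) (Fin 2 × Fin 2) ℂ) (x : X) (t : ℝ) :
    outcomeProb (rhoFamily β) E x t =
      ∑ i, rhoEigenvalues t i * (star (β i) ⬝ᵥ (E x *ᵥ β i)).re := by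
  rw [outcomeProb, rhoFamily_eq_spectralSum, trace_spectralSum_mul, Complex.re_sum]
  exact Finset.sum_congr rfl fun i _ => Complex.re_ofReal_mul _ _

theorem deriv_outcomeProb_rhoFamily {X : Type*}
    (E : X → Matrix (Fin 2 × Fin 2) (Fin 2 × Fin 2) ℂ) (x : X) (hθ : θ ∈ Set.Ioo (0 : ℝ) 1) :
    deriv (outcomeProb (rhoFamily β) E x) θ = ∑ i, rhoEigenvalues θ i * sldEigenvalues θ i *
      (star (β i) ⬝ᵥ (E x *ᵥ β i)).re := by
  rw [funext (outcomeProb_rhoFamily E x)]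
  refine (HasDerivAt.fun_sum fun i _ => (hasDerivAt_rhoEigenvalues θ i).mul_const _).deriv.trans ?_
  rw [← rhoEigenvalues_mul_sldEigenvalues hθ]
  rfl

theorem isSLD_sldFamily (hβ : (columns β)ᴴ * columns β = 1) (hθ : θ ∈ Set.Ioo (0 : ℝ) 1) :
    IsSLD (rhoFamily β) θ (sldFamily β θ) := by
  constructor
  · rw [sldFamily_eq_spectralSum, spectralSum, Matrix.IsHermitian]
    simp [Matrix.conjTranspose_mul, Matrix.diagonal_conjTranspose, Matrix.mul_assoc,
      Pi.star_def]
  · convert hasDerivAt_rhoFamily β hθ using 1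
    rw [rhoFamily_eq_spectralSum, sldFamily_eq_spectralSum, spectralSum_mul_spectralSum hβ,
      spectralSum_mul_spectralSum hβ, mul_comm (sldEigenvalues θ)]
    module

/-- A rank-three state on a four-dimensional space leaves the SLD free on the kernel; only its
action on the support is determined, and this suffices to treat every SLD at once. -/
theorem IsSLD.mul_columns {L : Matrix (Fin 2 × Fin 2) (Fin 2 × Fin 2) ℂ}
    (hβ : (columns β)ᴴ * columns β = 1) (hθ : θ ∈ Set.Ioo (0 : ℝ) 1)
    (h : IsSLD (rhoFamily β) θ L) :
    L * columns β = columns β * Matrix.diagonal fun i => (sldEigenvalues θ i : ℂ) := by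
  refine mul_columns_of_sld hβ (rhoEigenvalues_pos hθ) ?_
  rw [← rhoFamily_eq_spectralSum]
  exact hasDerivAt_matrix_unique h.2 (hasDerivAt_rhoFamily β hθ)

theorem columns_bell {k : Fin 3 → Fin 4} (hk : Function.Injective k)
    (hβ : ∀ i, β i = bell (k i)) : (columns β)ᴴ * columns β = 1 := by
  ext i j
  have h : ((columns β)ᴴ * columns β) i j = star (β i) ⬝ᵥ β j := rfl
  rw [h, hβ, hβ, star_bell_dotProduct_bell, Matrix.one_apply]
  simp only [hk.eq_iff]

end BellFamily

theorem mainTheorem8 {X : Type*} [DecidableEq X]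
    (k : Fin 3 → Fin 4) (hk : Function.Injective k) (β : Fin 3 → (Fin 2 × Fin 2 → ℂ))
    (hβ : ∀ i, β i = bell (k i)) (θ : ℝ) (hθ : θ ∈ Set.Ioo (0 : ℝ) 1) :
    -- a state of rank three, with the stated symmetric logarithmic derivative
    ((rhoFamily β θ).PosSemidef ∧ (rhoFamily β θ).trace = 1 ∧ (rhoFamily β θ).rank = 3) ∧
    IsSLD (rhoFamily β) θ (sldFamily β θ) ∧
    -- a saturating measurement perfectly distinguishes the three Bell states
    (∀ L, IsSLD (rhoFamily β) θ L →
      ∀ E : X → Matrix (Fin 2 × Fin 2) (Fin 2 × Fin 2) ℂ, IsPOVM E →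
        (IsQCRBSaturating (rhoFamily β θ) L E → PerfectlyDistinguishes E β) ∧
        (fisherInfo (rhoFamily β) θ E = ENNReal.ofReal (quantumFisherInfo (rhoFamily β θ) L) →
          PerfectlyDistinguishes E β)) ∧
    -- LOCC cannot perfectly distinguish them
    (∀ E : X → Matrix (Fin 2 × Fin 2) (Fin 2 × Fin 2) ℂ, IsLOCCMeasurement E →
      ¬ PerfectlyDistinguishes E β) ∧
    -- no LOCC measurement saturates the quantum Cramér–Rao bound
    (∀ L, IsSLD (rhoFamily β) θ L →
      ∀ E : X → Matrix (Fin 2 × Fin 2) (Fin 2 × Fin 2) ℂ, IsLOCCMeasurement E →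
        ¬ IsQCRBSaturating (rhoFamily β θ) L E ∧
        fisherInfo (rhoFamily β) θ E <
          ENNReal.ofReal (quantumFisherInfo (rhoFamily β θ) L)) := by
  have hV := columns_bell hk hβ
  have hpos := rhoEigenvalues_pos hθ
  have hinj := sldEigenvalues_injective hθ
  have hsat : ∀ L, IsSLD (rhoFamily β) θ L →
      ∀ E : X → Matrix (Fin 2 × Fin 2) (Fin 2 × Fin 2) ℂ, IsPOVM E →
        IsQCRBSaturating (rhoFamily β θ) L E → PerfectlyDistinguishes E β := by
    intro L hL E hE h
    rw [rhoFamily_eq_spectralSum] at h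
    exact h.perfectlyDistinguishes hV hpos hinj (hL.mul_columns hV hθ) hE
  have hfisher : ∀ L, IsSLD (rhoFamily β) θ L →
      ∀ E : X → Matrix (Fin 2 × Fin 2) (Fin 2 × Fin 2) ℂ, IsPOVM E →
        fisherInfo (rhoFamily β) θ E ≤ ENNReal.ofReal (quantumFisherInfo (rhoFamily β θ) L) ∧
        (fisherInfo (rhoFamily β) θ E = ENNReal.ofReal (quantumFisherInfo (rhoFamily β θ) L) →
          PerfectlyDistinguishes E β) := by
    intro L hL E hE
    rw [rhoFamily_eq_spectralSum β θ]
    exact fisherInfo_le_and_perfectlyDistinguishes hV hpos hinj (hL.mul_columns hV hθ) hE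
      (fun x => outcomeProb_rhoFamily E x θ) (fun x => deriv_outcomeProb_rhoFamily E x hθ)
  have hlocc : ∀ E : X → Matrix (Fin 2 × Fin 2) (Fin 2 × Fin 2) ℂ, IsLOCCMeasurement E →
      ¬ PerfectlyDistinguishes E β := fun E hE => by
    rw [funext hβ]
    exact not_perfectlyDistinguishes_bell hE.1 hE.posSemidef_partialTranspose k
  refine ⟨?_, isSLD_sldFamily hV hθ,
    fun L hL E hE => ⟨hsat L hL E hE, (hfisher L hL E hE).2⟩, hlocc,
    fun L hL E hE => ⟨fun h => hlocc E hE (hsat L hL E hE.1 h),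
      (hfisher L hL E hE.1).1.lt_of_ne fun h => hlocc E hE ((hfisher L hL E hE.1).2 h)⟩⟩
  rw [rhoFamily_eq_spectralSum]
  refine ⟨posSemidef_spectralSum β fun i => (hpos i).le, ?_,
    (rank_spectralSum hV fun i => (hpos i).ne').trans (Fintype.card_fin 3)⟩
  rw [trace_spectralSum hV, Complex.ofReal_eq_one, Fin.sum_univ_three]
  simp only [rhoEigenvalues, Matrix.cons_val]
  ring
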